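/- Let $\mathcal P=\left(\frac{p_{1,1}}{p_{1,2}},\frac{p_{2,1}}{p_{1,2}}\right)\in\mathbb C(t)^2$ be a rational parametrization of a plane curve $\mathcal C$, with $p_{1,2}\neq 0$, $\gcd(p_{k,1},p_{1,2})=1$ and $\deg p_{k,1}=\deg p_{1,2}$ for $k=1,2$, and with tracing index $1$ (all but finitely many points of $\mathcal C$ are attained at exactly one parameter value). Let $R=M/N\in\mathbb C(t)\setminus\mathbb C$ with $\gcd(M,N)=1$, $M N\notin\mathbb C$, put $\ell=\deg R=\max(\deg M,\deg N)$, and assume that no pole of $\mathcal P$ is a pole of $R$, i.e. $\gcd(N,p_{1,2})=1$. For $k=1,2$ let $$L_k(s,x_k)=\operatorname{Res}_t\bigl(x_k\,p_{1,2}(t)-p_{k,1}(t),\; s\,N(t)-M(t)\bigr),$$ $$\widetilde q_{k,2}(s)=\operatorname{coeff}(L_k,x_k^{\ell}),\qquad \widetilde q_{k,1}(s)=-\tfrac1\ell\operatorname{coeff}(L_k,x_k^{\ell-1}),$$ so that $\widetilde q_{1,2}=\widetilde q_{2,2}$ and $\widetilde q_{k,1}/\widetilde q_{k,2}$ is the root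 in $x_k$ of $\partial^{\ell-1}L_k/\partial x_k^{\ell-1}$. Let $\widetilde{\mathcal D}$ be the curve parametrized by the unsimplified output parametrization $\widetilde{\mathcal Q}=\left(\frac{\widetilde q_{1,1}}{\widetilde q_{1,2}},\frac{\widetilde q_{2,1}}{\widetilde q_{2,2}}\right)$, and assume that $\widetilde q_{k,2}\ne 0$, $\gcd(\widetilde q_{k,1},\widetilde q_{k,2})=1$, $\deg\widetilde q_{k,1}=\deg\widetilde q_{k,2}$ for $k=1,2$, and that $\widetilde{\mathcal Q}$ has tracing index $1$. Let $f,h\in\mathbb C[x_1,x_2]$ be the irreducible polynomials (unique up to a nonzero constant factor) that define $\mathcal C$ and $\widetilde{\mathcal D}$ implicitly. Then $f$ and $h$ have the same homogeneous form of maximum degree, up to a nonzero constant factor, and $\mathcal C$ and $\widetilde{\mathcal D}$ have the same points at infinity. -/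

import Mathlib

open Polynomial
open scoped LinearAlgebra.Projectivization

/-- A pair of quotients of univariate complex polynomials, read as a rational parametrization
`t ↦ (num 0 (t) / den 0 (t), num 1 (t) / den 1 (t))` in the affine plane. -/
structure PlaneParam where
  num : Fin 2 → ℂ[X]
  den : Fin 2 → ℂ[X]

namespace PlaneParam

/-- The parameter values at which both components are defined. -/
def domain (P : PlaneParam) : Set ℂ :=
  {t | ∀ k, (P.den k).eval t ≠ 0}

/-- The point of the affine plane with parameter `t` (meaningful for `t ∈ P.domain`). -/
noncomputable def point (P : PlaneParam) (t : ℂ) : Fin 2 → ℂ :=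
  fun k => (P.num k).eval t / (P.den k).eval t

/-- The algebraic set parametrized by `P`: the Zariski closure of its image in `ℂ²`. -/
noncomputable def curve (P : PlaneParam) : Set (Fin 2 → ℂ) :=
  MvPolynomial.zeroLocus ℂ (MvPolynomial.vanishingIdeal ℂ (P.point '' P.domain))

/-- `P` has tracing index `m`: all but finitely many points of the curve are generated by exactly
`m` parameter values. -/
def HasTracingIndex (P : PlaneParam) (m : ℕ) : Prop :=
  {x ∈ P.curve | {t ∈ P.domain | P.point t = x}.encard ≠ m}.Finite

/-- Each component is a quotient in lowest terms with nonzero denominator, whose numerator and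
denominator have the same degree. -/
structure IsReduced (P : PlaneParam) : Prop where
  den_ne_zero : ∀ k, P.den k ≠ 0
  coprime : ∀ k, IsCoprime (P.num k) (P.den k)
  natDegree_eq : ∀ k, (P.num k).natDegree = (P.den k).natDegree

/-- The polynomial `G_k(t, x) = x * den_k(t) - num_k(t)`. The outermost variable is `t`, the
middle one is `x`, the innermost one is `s` (which does not occur here). -/
noncomputable def polyG (P : PlaneParam) (k : Fin 2) : ℂ[X][X][X] :=
  C X * (P.den k).map (algebraMap ℂ ℂ[X][X]) - (P.num k).map (algebraMap ℂ ℂ[X][X])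

/-- The polynomial `s * N(t) - M(t)`, with the variables arranged as in `polyG`. -/
noncomputable def polyR (M N : ℂ[X]) : ℂ[X][X][X] :=
  C (C X) * N.map (algebraMap ℂ ℂ[X][X]) - M.map (algebraMap ℂ ℂ[X][X])

/-- `L_k(s, x) = Res_t(G_k(t, x), s * N(t) - M(t))`, a polynomial in `x` (outer variable) with
coefficients in `ℂ[s]`. -/
noncomputable def polyL (P : PlaneParam) (M N : ℂ[X]) (k : Fin 2) : ℂ[X][X] :=
  resultant (P.polyG k) (polyR M N)

/-- The unsimplified output parametrization for `R = M / N` (coprime), with `ℓ = deg R`: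
its `k`-th component is `(-coeff(L_k, x^(ℓ-1)) / ℓ) / coeff(L_k, x^ℓ)`, that is, the root in `x` of
the `(ℓ-1)`-st derivative of `L_k` with respect to `x`. -/
noncomputable def output (P : PlaneParam) (M N : ℂ[X]) : PlaneParam where
  num k := C (-((max M.natDegree N.natDegree : ℕ) : ℂ)⁻¹) *
    (P.polyL M N k).coeff (max M.natDegree N.natDegree - 1)
  den k := (P.polyL M N k).coeff (max M.natDegree N.natDegree)

end PlaneParam

/-- `f` is an implicit polynomial of the plane curve `V`: it is irreducible and its zero set
is `V`. -/
def IsImplicitPolynomial (f : MvPolynomial (Fin 2) ℂ) (V : Set (Fin 2 → ℂ)) : Prop :=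
  Irreducible f ∧ ∀ x, x ∈ V ↔ MvPolynomial.eval x f = 0

/-- The homogeneous form of maximum degree of `f`. -/
noncomputable def topForm (f : MvPolynomial (Fin 2) ℂ) : MvPolynomial (Fin 2) ℂ :=
  MvPolynomial.homogeneousComponent f.totalDegree f

/-- The points at infinity of an affine plane set `V`: the points with last coordinate zero of the
projective (Zariski) closure of `{[x₁ : x₂ : 1] | (x₁, x₂) ∈ V}` in the projective plane. -/
def pointsAtInfinity (V : Set (Fin 2 → ℂ)) : Set (ℙ ℂ (Fin 3 → ℂ)) :=
  {q | q.rep 2 = 0 ∧ ∀ (F : MvPolynomial (Fin 3) ℂ) (n : ℕ), F.IsHomogeneous n →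
    (∀ x ∈ V, MvPolynomial.eval ![x 0, x 1, 1] F = 0) → MvPolynomial.eval q.rep F = 0}

/-! The poles of a parametrization already determine the top form. Let `d` be the common
denominator, `n` its degree and `p₀`, `p₁` the numerators. The resultant of `x₀ d - p₀` and `x₁ d -
p₁` in `t` vanishes on the curve, has degree at most `n`, and its form of degree `n` is a nonzero
constant times `∏ (p₀(a) x₁ - p₁(a) x₀)` over the roots `a` of `d` with multiplicity
(`homogeneousComponent_implicitResultant`). Tracing index one forces the implicit polynomial to have
degree at least `n`, because a general line `x₀ = c` meets the curve in `n` points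
(`natDegree_den_le_totalDegree`). It divides the resultant, so it equals it up to a constant.

It remains to compare the two products. The poles of the output are the values `R(a)`, with
multiplicity (`roots_output_den`). At `s = R(a)` the polynomial `s N - M` splits as `(t - a) E(t)`,
so `L_k(s, x)` is `± p_k(a) Res(x d - p_k, E)`. The coefficient of `x ^ (ℓ - 1)` in the last
resultant is `Res(d, E)`, the same for both `k`. Hence the linear factors agree up to scalars.
Finally, the points at infinity are the zeros of the top form. -/

/-! ### Resultants of linear pencils -/

namespace Polynomial

variable {R : Type*} [CommRing R]

/-- The resultant of a linear pencil `x * d - p` with a polynomial `E` that does not involve `x`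
has degree at most `m` in `x`. -/
theorem natDegree_resultant_pencil_le (d p E : R[X]) (n m : ℕ) :
    (resultant (C X * d.map C - p.map C) (E.map C) n m).natDegree ≤ m := by
  rw [resultant, Matrix.det_apply]
  refine natDegree_sum_le_of_forall_le _ _ fun σ _ => ?_
  refine (natDegree_smul_le _ _).trans ?_
  -- Of the Sylvester columns, `n` carry coefficients of `E`, constant in `x`, and `m` carry those
  -- of the pencil, of degree at most one in `x`.
  rw [Fin.prod_univ_add]
  refine natDegree_mul_le.trans ?_
  have h1 : (∏ i : Fin n, sylvester (C X * d.map C - p.map C) (E.map C) n m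
      (σ (Fin.castAdd m i)) (Fin.castAdd m i)).natDegree ≤ 0 := by
    refine (natDegree_prod_le _ _).trans (Finset.sum_nonpos fun i _ => ?_)
    simp only [sylvester, Matrix.of_apply, Fin.addCases_left, coeff_map]
    split_ifs <;> simp
  have h2 : (∏ i : Fin m, sylvester (C X * d.map C - p.map C) (E.map C) n m
      (σ (Fin.natAdd n i)) (Fin.natAdd n i)).natDegree ≤ m := by
    refine (natDegree_prod_le _ _).trans
      ((Finset.sum_le_card_nsmul _ _ 1 fun i _ => ?_).trans (by simp))
    simp only [sylvester, Matrix.of_apply, Fin.addCases_right, coeff_sub, coeff_C_mul, coeff_map]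
    split_ifs
    · compute_degree
    · simp
  omega

/-- The coefficient of `x ^ m` in the resultant of a linear pencil `x * d - p` with a polynomial
`E` of formal degree `m` is the resultant of `d` and `E`. -/
theorem coeff_resultant_pencil (d p E : R[X]) (n m : ℕ) :
    (resultant (C X * d.map C - p.map C) (E.map C) n m).coeff m = resultant d E n m := by
  rw [resultant, resultant, Matrix.det_apply, Matrix.det_apply, finsetSum_coeff]
  refine Finset.sum_congr rfl fun σ _ => ?_
  rw [Units.smul_def, Units.smul_def, coeff_smul]
  congr 1
  rw [Fin.prod_univ_add, Fin.prod_univ_add]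
  have h1 : (∏ i : Fin n, sylvester (C X * d.map C - p.map C) (E.map C) n m
      (σ (Fin.castAdd m i)) (Fin.castAdd m i)) =
      C (∏ i : Fin n, sylvester d E n m (σ (Fin.castAdd m i)) (Fin.castAdd m i)) := by
    rw [map_prod]
    refine Finset.prod_congr rfl fun i _ => ?_
    simp only [sylvester, Matrix.of_apply, Fin.addCases_left, coeff_map]
    split_ifs <;> simp
  rw [h1, coeff_C_mul]
  congr 1
  have h2 := coeff_prod_of_natDegree_le (s := Finset.univ) (fun i : Fin m =>
    sylvester (C X * d.map C - p.map C) (E.map C) n m (σ (Fin.natAdd n i)) (Fin.natAdd n i)) 1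
    (fun i _ => by
      simp only [sylvester, Matrix.of_apply, Fin.addCases_right, coeff_sub, coeff_C_mul, coeff_map]
      split_ifs
      · compute_degree
      · simp)
  rw [Finset.card_univ, Fintype.card_fin, mul_one] at h2
  rw [h2]
  refine Finset.prod_congr rfl fun i _ => ?_
  simp only [sylvester, Matrix.of_apply, Fin.addCases_right, coeff_sub, coeff_C_mul, coeff_map]
  split_ifs
  · simp [coeff_C]
  · simp

/-- Multiplicativity of the resultant when the second factor has a formal degree. -/
theorem resultant_mul_right_of_natDegree_le (f g₁ g₂ : R[X]) {m n : ℕ} (hf : f.natDegree ≤ m)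
    (hg : g₂.natDegree ≤ n) :
    resultant f (g₁ * g₂) m (g₁.natDegree + n) = resultant f g₁ m * resultant f g₂ m n := by
  obtain ⟨k, rfl⟩ := Nat.exists_eq_add_of_le hg
  rw [← add_assoc, resultant_add_right_deg _ _ _ _ _ natDegree_mul_le,
    resultant_mul_right _ _ _ _ hf, resultant_add_right_deg _ _ _ _ _ le_rfl]
  ring

/-- A resultant of positive formal degree vanishes if there is a common root. -/
theorem resultant_eq_zero_of_common_root (f g : R[X]) {m n : ℕ} (hf : f.natDegree ≤ m)
    (hg : g.natDegree ≤ n) (hm : m ≠ 0) {t : R} (hft : f.eval t = 0) (hgt : g.eval t = 0) :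
    resultant f g m n = 0 := by
  obtain ⟨p, q, -, -, h⟩ := exists_mul_add_mul_eq_C_resultant f g hf hg (Or.inl hm)
  simpa [hft, hgt] using (congrArg (eval t) h).symm

end Polynomial

/-! ### Homogeneous components through restriction to lines -/

namespace MvPolynomial

variable {σ K : Type*} [Field K]

/-- Restriction of a polynomial to the line through the origin with direction `w`. -/
noncomputable def restrictLine (w : σ → K) : MvPolynomial σ K →ₐ[K] Polynomial K :=
  aeval fun i => Polynomial.C (w i) * Polynomial.X

theorem coeff_restrictLine (w : σ → K) (f : MvPolynomial σ K) (n : ℕ) :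
    (restrictLine w f).coeff n = eval w (homogeneousComponent n f) := by
  induction f using MvPolynomial.induction_on' with
  | monomial s a =>
    rw [homogeneousComponent_of_mem (isHomogeneous_monomial a rfl)]
    have : restrictLine w (monomial s a) =
        Polynomial.C (eval w (monomial s a)) * Polynomial.X ^ s.degree := by
      simp only [restrictLine, aeval_monomial, eval_monomial, Finsupp.prod, mul_pow,
        Finset.prod_mul_distrib, Finset.prod_pow_eq_pow_sum, Finsupp.degree, map_mul, map_prod,
        map_pow, Polynomial.algebraMap_eq, mul_assoc]
      rfl
    rw [this, Polynomial.coeff_C_mul_X_pow]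
    split_ifs <;> simp
  | add p q hp hq => simp [hp, hq]

/-- A polynomial that vanishes off a coordinate hyperplane is zero. -/
theorem eq_zero_of_eval_eq_zero_of_ne [Infinite K] (i : σ) {f : MvPolynomial σ K}
    (h : ∀ w : σ → K, w i ≠ 0 → eval w f = 0) : f = 0 := by
  have : X i * f = 0 := by
    refine MvPolynomial.funext fun w => ?_
    by_cases hw : w i = 0
    · simp [hw]
    · simp [h w hw]
  exact (mul_eq_zero.mp this).resolve_left (X_ne_zero i)

theorem natDegree_restrictLine_le (w : σ → K) (f : MvPolynomial σ K) :
    (restrictLine w f).natDegree ≤ f.totalDegree := by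
  refine Polynomial.natDegree_le_iff_coeff_eq_zero.mpr fun n hn => ?_
  rw [coeff_restrictLine, homogeneousComponent_eq_zero _ _ hn, map_zero]

/-- The homogeneous form of degree `m + n` of a product of polynomials of degrees at most `m`
and `n`. -/
theorem eval_homogeneousComponent_mul (w : σ → K) {f g : MvPolynomial σ K} {m n : ℕ}
    (hf : f.totalDegree ≤ m) (hg : g.totalDegree ≤ n) :
    eval w (homogeneousComponent (m + n) (f * g)) =
      eval w (homogeneousComponent m f) * eval w (homogeneousComponent n g) := by
  simp only [← coeff_restrictLine, map_mul]
  exact Polynomial.coeff_mul_add_eq_of_natDegree_le ((natDegree_restrictLine_le w f).trans hf)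
    ((natDegree_restrictLine_le w g).trans hg)

end MvPolynomial

/-! ### Implicit polynomials and points at infinity -/

namespace IsImplicitPolynomial

variable {f : MvPolynomial (Fin 2) ℂ} {V : Set (Fin 2 → ℂ)}

/-- Nullstellensatz for the prime ideal generated by `f`. -/
theorem dvd (hf : IsImplicitPolynomial f V) {p : MvPolynomial (Fin 2) ℂ}
    (hp : ∀ x ∈ V, MvPolynomial.eval x p = 0) : f ∣ p := by
  have hprime : (Ideal.span {f}).IsPrime :=
    (Ideal.span_singleton_prime hf.1.ne_zero).mpr hf.1.prime
  rw [← Ideal.mem_span_singleton,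
    ← MvPolynomial.IsPrime.vanishingIdeal_zeroLocus (K := ℂ) (Ideal.span {f})]
  intro x hx
  rw [MvPolynomial.zeroLocus_span] at hx
  have := hx f rfl
  rw [MvPolynomial.aeval_eq_eval] at this ⊢
  exact hp x ((hf.2 x).mpr this)

end IsImplicitPolynomial

/-- The homogenization of a polynomial in two variables, as a form of degree `n`. -/
noncomputable def homogenization (f : MvPolynomial (Fin 2) ℂ) (n : ℕ) : MvPolynomial (Fin 3) ℂ :=
  ∑ j ∈ Finset.range (n + 1), MvPolynomial.rename (Fin.castSucc : Fin 2 → Fin 3)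
    (MvPolynomial.homogeneousComponent j f) * MvPolynomial.X 2 ^ (n - j)

theorem homogenization_isHomogeneous (f : MvPolynomial (Fin 2) ℂ) (n : ℕ) :
    (homogenization f n).IsHomogeneous n := by
  refine MvPolynomial.IsHomogeneous.sum _ _ _ fun j hj => ?_
  have h := ((MvPolynomial.homogeneousComponent_isHomogeneous j f).rename_isHomogeneous
    (f := (Fin.castSucc : Fin 2 → Fin 3))).mul
      ((MvPolynomial.isHomogeneous_X ℂ (2 : Fin 3)).pow (n - j))
  have hj' : j + 1 * (n - j) = n := by
    have := Finset.mem_range.mp hj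
    omega
  rwa [hj'] at h

theorem eval_homogenization_one (f : MvPolynomial (Fin 2) ℂ) (x : Fin 2 → ℂ) :
    MvPolynomial.eval ![x 0, x 1, 1] (homogenization f f.totalDegree) =
      MvPolynomial.eval x f := by
  have hx : (![x 0, x 1, 1] : Fin 3 → ℂ) ∘ Fin.castSucc = x := by
    funext i
    fin_cases i <;> rfl
  conv_rhs => rw [← MvPolynomial.sum_homogeneousComponent f]
  simp [homogenization, MvPolynomial.eval_rename, hx]

theorem eval_homogenization_infinity (f : MvPolynomial (Fin 2) ℂ) (w : Fin 3 → ℂ) (hw : w 2 = 0) :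
    MvPolynomial.eval w (homogenization f f.totalDegree) =
      MvPolynomial.eval ![w 0, w 1] (topForm f) := by
  have hx : w ∘ Fin.castSucc = ![w 0, w 1] := by
    funext i
    fin_cases i <;> rfl
  rw [homogenization, map_sum, Finset.sum_eq_single f.totalDegree]
  · simp [MvPolynomial.eval_rename, hx, topForm]
  · intro j hj hne
    have : f.totalDegree - j ≠ 0 := by
      have := Finset.mem_range.mp hj
      omega
    simp [hw, this]
  · simp

/-- Dehomogenization with respect to the last of three variables. -/
noncomputable def dehomogenization : MvPolynomial (Fin 3) ℂ →ₐ[ℂ] MvPolynomial (Fin 2) ℂ :=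
  MvPolynomial.aeval ![MvPolynomial.X 0, MvPolynomial.X 1, 1]

theorem eval_dehomogenization (F : MvPolynomial (Fin 3) ℂ) (x : Fin 2 → ℂ) :
    MvPolynomial.eval x (dehomogenization F) = MvPolynomial.eval ![x 0, x 1, 1] F := by
  rw [dehomogenization, MvPolynomial.aeval_def, ← MvPolynomial.coe_eval₂Hom]
  change ((MvPolynomial.eval x).comp _) F = _
  congr 1
  refine MvPolynomial.ringHom_ext (fun r => by simp) fun i => ?_
  fin_cases i <;> simp

theorem dehomogenization_monomial (s : Fin 3 →₀ ℕ) (a : ℂ) :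
    dehomogenization (MvPolynomial.monomial s a) =
      MvPolynomial.C a * (MvPolynomial.X 0 ^ s 0 * MvPolynomial.X 1 ^ s 1) := by
  rw [dehomogenization, MvPolynomial.aeval_monomial, Finsupp.prod_fintype _ _ (by simp),
    Fin.prod_univ_three]
  simp [MvPolynomial.algebraMap_eq]

theorem totalDegree_dehomogenization_le {F : MvPolynomial (Fin 3) ℂ} {n : ℕ}
    (hF : F.IsHomogeneous n) : (dehomogenization F).totalDegree ≤ n := by
  rw [F.as_sum, map_sum]
  refine MvPolynomial.totalDegree_finsetSum_le fun s hs => ?_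
  have hdeg : s.degree = n := by
    rw [Finsupp.degree_eq_weight_one]
    exact hF (MvPolynomial.mem_support_iff.mp hs)
  rw [Finsupp.degree_eq_sum, Fin.sum_univ_three] at hdeg
  rw [dehomogenization_monomial]
  have h : (MvPolynomial.C (MvPolynomial.coeff s F) * (MvPolynomial.X 0 ^ s 0 *
      MvPolynomial.X 1 ^ s 1) : MvPolynomial (Fin 2) ℂ).IsHomogeneous
        (0 + (1 * s 0 + 1 * s 1)) :=
    (MvPolynomial.isHomogeneous_C _ _).mul (((MvPolynomial.isHomogeneous_X _ _).pow _).mul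
      ((MvPolynomial.isHomogeneous_X _ _).pow _))
  have := h.totalDegree_le
  omega

/-- Setting the last variable to 1 lowers the degree of exactly those monomials that contain it, and
these vanish at `w`. -/
theorem eval_homogeneousComponent_dehomogenization {F : MvPolynomial (Fin 3) ℂ} {n : ℕ}
    (hF : F.IsHomogeneous n) (w : Fin 3 → ℂ) (hw : w 2 = 0) :
    MvPolynomial.eval ![w 0, w 1] (MvPolynomial.homogeneousComponent n (dehomogenization F)) =
      MvPolynomial.eval w F := by
  conv_lhs => rw [F.as_sum]
  conv_rhs => rw [F.as_sum]
  simp only [map_sum]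
  refine Finset.sum_congr rfl fun s hs => ?_
  have hdeg : s.degree = n := by
    rw [Finsupp.degree_eq_weight_one]
    exact hF (MvPolynomial.mem_support_iff.mp hs)
  rw [Finsupp.degree_eq_sum, Fin.sum_univ_three] at hdeg
  rw [dehomogenization_monomial]
  have h : (MvPolynomial.C (MvPolynomial.coeff s F) * (MvPolynomial.X 0 ^ s 0 *
      MvPolynomial.X 1 ^ s 1) : MvPolynomial (Fin 2) ℂ).IsHomogeneous
        (0 + (1 * s 0 + 1 * s 1)) :=
    (MvPolynomial.isHomogeneous_C _ _).mul (((MvPolynomial.isHomogeneous_X _ _).pow _).mul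
      ((MvPolynomial.isHomogeneous_X _ _).pow _))
  rw [MvPolynomial.homogeneousComponent_of_mem h, MvPolynomial.eval_monomial,
    Finsupp.prod_fintype _ _ (by simp), Fin.prod_univ_three]
  by_cases h2 : s 2 = 0
  · rw [if_pos (by omega)]
    simp [h2]
  · rw [if_neg (by omega)]
    simp [hw, h2]

/-- The points at infinity of an algebraic curve are the zeros at infinity of the homogeneous form
of maximum degree of its implicit polynomial. -/
theorem IsImplicitPolynomial.mem_pointsAtInfinity_iff {f : MvPolynomial (Fin 2) ℂ}
    {V : Set (Fin 2 → ℂ)} (hf : IsImplicitPolynomial f V) (q : ℙ ℂ (Fin 3 → ℂ)) :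
    q ∈ pointsAtInfinity V ↔
      q.rep 2 = 0 ∧ MvPolynomial.eval ![q.rep 0, q.rep 1] (topForm f) = 0 := by
  constructor
  · rintro ⟨h2, h⟩
    refine ⟨h2, ?_⟩
    rw [← eval_homogenization_infinity f _ h2]
    refine h _ _ (homogenization_isHomogeneous f _) fun x hx => ?_
    rw [eval_homogenization_one]
    exact (hf.2 x).mp hx
  · rintro ⟨h2, h⟩
    refine ⟨h2, fun F n hF hV => ?_⟩
    rw [← eval_homogeneousComponent_dehomogenization hF _ h2]
    -- As `f` divides the dehomogenized `F`, the part of degree `n` is the top form of `f` times a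
    -- component of the cofactor.
    obtain ⟨g, hg⟩ := hf.dvd (p := dehomogenization F) fun x hx => by
      rw [eval_dehomogenization, hV x hx]
    by_cases hg0 : g = 0
    · simp [hg, hg0]
    have hdeg := totalDegree_dehomogenization_le hF
    rw [hg, MvPolynomial.totalDegree_mul_of_isDomain hf.1.ne_zero hg0] at hdeg
    obtain ⟨k, hk⟩ := Nat.exists_eq_add_of_le hdeg
    rw [hg, hk, add_assoc, MvPolynomial.eval_homogeneousComponent_mul _ le_rfl (by omega)]
    rw [topForm] at h
    rw [h, zero_mul]

/-! ### The top form of a parametrized curve -/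

namespace PlaneParam

variable {P : PlaneParam}

theorem point_mem_curve {t : ℂ} (ht : t ∈ P.domain) : P.point t ∈ P.curve :=
  MvPolynomial.zeroLocus_vanishingIdeal_le _ ⟨t, ht, rfl⟩

theorem eval_eq_zero_of_mem_curve {p : MvPolynomial (Fin 2) ℂ}
    (hp : ∀ t ∈ P.domain, MvPolynomial.eval (P.point t) p = 0) {x : Fin 2 → ℂ}
    (hx : x ∈ P.curve) : MvPolynomial.eval x p = 0 := by
  have := hx p (by
    rintro _ ⟨t, ht, rfl⟩
    rw [MvPolynomial.aeval_eq_eval]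
    exact hp t ht)
  rwa [MvPolynomial.aeval_eq_eval] at this

theorem mem_domain_iff (hden : P.den 0 = P.den 1) {t : ℂ} :
    t ∈ P.domain ↔ (P.den 0).eval t ≠ 0 := by
  simp [domain, Fin.forall_fin_two, hden]

theorem den_eq (hden : P.den 0 = P.den 1) (k : Fin 2) : P.den k = P.den 0 := by
  fin_cases k
  · rfl
  · exact hden.symm

namespace IsReduced

theorem num_eval_ne_zero (hP : P.IsReduced) {k : Fin 2} {t : ℂ} (ht : (P.den k).eval t = 0) :
    (P.num k).eval t ≠ 0 := by
  intro h
  obtain ⟨a, b, hab⟩ := hP.coprime k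
  have := congrArg (eval t) hab
  simp [h, ht] at this

/-- A reduced parametrization that admits an implicit polynomial is not constant. -/
theorem natDegree_den_ne_zero (hP : P.IsReduced) (hden : P.den 0 = P.den 1)
    {f : MvPolynomial (Fin 2) ℂ} (hf : IsImplicitPolynomial f P.curve) :
    (P.den 0).natDegree ≠ 0 := by
  intro h0
  have hnum : ∀ k, (P.num k).natDegree = 0 := fun k => by
    rw [hP.natDegree_eq, den_eq hden, h0]
  have hconst : ∀ t, P.point t = P.point 0 := fun t => by
    funext k
    rw [point, point, eq_C_of_natDegree_eq_zero (hnum k), den_eq hden,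
      eq_C_of_natDegree_eq_zero h0]
    simp
  -- If the curve were one point, `f` would divide two linear polynomials, each then a scalar
  -- multiple of `f`; but these two are not proportional.
  have hdvd : ∀ k, f ∣ MvPolynomial.X k - MvPolynomial.C (P.point 0 k) := fun k =>
    hf.dvd fun x hx => eval_eq_zero_of_mem_curve (fun t _ => by simp [hconst t]) hx
  have hne : ∀ k : Fin 2, (MvPolynomial.X k - MvPolynomial.C (P.point 0 k) :
      MvPolynomial (Fin 2) ℂ) ≠ 0 := fun k h => by
    have := congrArg (MvPolynomial.eval fun i => P.point 0 i + 1) h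
    simp at this
  have hdeg : ∀ k : Fin 2, (MvPolynomial.X k - MvPolynomial.C (P.point 0 k) :
      MvPolynomial (Fin 2) ℂ).totalDegree ≤ 1 := fun k =>
    (MvPolynomial.totalDegree_sub_C_le _ _).trans (MvPolynomial.totalDegree_X k).le
  have hf0 : f.totalDegree ≠ 0 := fun h => by
    have hC := MvPolynomial.totalDegree_eq_zero_iff_eq_C.mp h
    refine hf.1.not_isUnit ?_
    have hc : MvPolynomial.coeff 0 f ≠ 0 := fun hz => hf.1.ne_zero (by rw [hC, hz, map_zero])
    rw [hC]
    exact (IsUnit.mk0 _ hc).map MvPolynomial.C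
  have hlin : ∀ k : Fin 2, ∃ c : ℂ, MvPolynomial.X k - MvPolynomial.C (P.point 0 k) =
      f * MvPolynomial.C c := fun k => by
    obtain ⟨g, hg⟩ := hdvd k
    have hg0 : g ≠ 0 := fun h => hne k (by rw [hg, h, mul_zero])
    have := hdeg k
    rw [hg, MvPolynomial.totalDegree_mul_of_isDomain hf.1.ne_zero hg0] at this
    have hgC := MvPolynomial.totalDegree_eq_zero_iff_eq_C.mp (show g.totalDegree = 0 by omega)
    exact ⟨_, by rw [hg, ← hgC]⟩
  obtain ⟨a, ha⟩ := hlin 0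
  obtain ⟨b, hb⟩ := hlin 1
  have hb' := congrArg (MvPolynomial.eval ![P.point 0 0 + 1, P.point 0 1]) hb
  have ha' := congrArg (MvPolynomial.eval ![P.point 0 0 + 1, P.point 0 1]) ha
  simp only [map_sub, map_mul, MvPolynomial.eval_X, MvPolynomial.eval_C, Matrix.cons_val_zero,
    Matrix.cons_val_one, sub_self, add_sub_cancel_left] at ha' hb'
  have hfz := left_ne_zero_of_mul (ha'.symm ▸ one_ne_zero)
  have hb0 : b = 0 := (mul_eq_zero.mp hb'.symm).resolve_left hfz
  exact hne 1 (by rw [hb, hb0, map_zero, mul_zero])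

/-- The lines `x = c` through infinitely many points of a curve with an injective parametrization
meet it in as many points as the degree of the parametrization; hence the degree of the
implicit polynomial is at least the degree of the parametrization. -/
theorem natDegree_den_le_totalDegree (hP : P.IsReduced) (hden : P.den 0 = P.den 1)
    (hindex : P.HasTracingIndex 1) {f : MvPolynomial (Fin 2) ℂ}
    (hf : IsImplicitPolynomial f P.curve) : (P.den 0).natDegree ≤ f.totalDegree := by
  have hn := hP.natDegree_den_ne_zero hden hf
  set d := P.den 0 with hd
  set p := P.num 0 with hp
  have hd0 : d ≠ 0 := hP.den_ne_zero 0
  have hpd : p.natDegree = d.natDegree := hP.natDegree_eq 0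
  -- The numerator of the derivative of `p / d`. If it vanished, coprimality would give `d ∣ d'`,
  -- hence `d' = 0`.
  have hwr : derivative p * d - p * derivative d ≠ 0 := by
    intro h
    have hdvd : d ∣ p * derivative d := ⟨derivative p, by rw [mul_comm d]; exact (sub_eq_zero.mp h).symm⟩
    have hdvd' := (hP.coprime 0).symm.dvd_of_dvd_mul_left hdvd
    have hder := eq_zero_of_dvd_of_natDegree_lt hdvd' (natDegree_derivative_lt hn)
    exact hn (derivative_eq_zero.mp hder)
  -- Values of `c` to avoid: abscissas of points without exactly one parameter, critical values of
  -- `p / d`, and its value at infinity.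
  have hbad : ((fun x : Fin 2 → ℂ => x 0) ''
      {x ∈ P.curve | {t ∈ P.domain | P.point t = x}.encard ≠ (1 : ℕ)} ∪
      ((fun t => p.eval t / d.eval t) '' {t | (derivative p * d - p * derivative d).IsRoot t} ∪
      {p.coeff d.natDegree / d.coeff d.natDegree})).Finite :=
    (hindex.image _).union (((finite_setOfPred_isRoot hwr).image _).union (Set.finite_singleton _))
  obtain ⟨c, hc⟩ := hbad.exists_notMem
  simp only [Set.mem_union, not_or, Set.mem_singleton_iff] at hc
  obtain ⟨hc1, hc2, hc3⟩ := hc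
  have hunique : ∀ x ∈ P.curve, x 0 = c → {t ∈ P.domain | P.point t = x}.encard = 1 := by
    intro x hx hxc
    by_contra hne
    exact hc1 ⟨x, ⟨hx, by simpa using hne⟩, hxc⟩
  -- The roots of `A` are the parameters of the points with abscissa `c`. Avoiding the value at
  -- infinity keeps the degree from dropping, and avoiding critical values makes the roots simple.
  set A : ℂ[X] := p - C c * d with hA
  have hlc : d.coeff d.natDegree ≠ 0 := by simpa using hd0
  have hAn : A.coeff d.natDegree ≠ 0 := by
    intro h
    refine hc3 ?_
    rw [hA, coeff_sub, coeff_C_mul, sub_eq_zero] at h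
    rw [eq_div_iff hlc, h]
  have hA0 : A ≠ 0 := fun h => hAn (by rw [h, coeff_zero])
  have hAdeg : d.natDegree ≤ A.natDegree := le_natDegree_of_ne_zero hAn
  have hroot : ∀ t, A.IsRoot t → d.eval t ≠ 0 ∧ p.eval t / d.eval t = c := by
    intro t ht
    have ht' : p.eval t = c * d.eval t := by
      simpa [hA, IsRoot, sub_eq_zero] using ht
    have hdt : d.eval t ≠ 0 := fun h => hP.num_eval_ne_zero (k := 0) h (by
      rw [← hp, ht', h, mul_zero])
    exact ⟨hdt, by rw [ht', mul_div_assoc, div_self hdt, mul_one]⟩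
  have hnodup : A.roots.Nodup := by
    rw [Multiset.nodup_iff_count_le_one]
    intro t
    rw [count_roots]
    by_contra! h
    obtain ⟨h1, h2⟩ := (one_lt_rootMultiplicity_iff_isRoot hA0).mp h
    obtain ⟨hdt, hct⟩ := hroot t h1
    refine hc2 ⟨t, ?_, hct⟩
    have h1' : p.eval t = c * d.eval t := by
      simpa [hA, IsRoot, sub_eq_zero] using h1
    have h2' : (derivative p).eval t = c * (derivative d).eval t := by
      simpa [hA, IsRoot, sub_eq_zero] using h2
    simp only [Set.mem_ofPred_eq, IsRoot, eval_sub, eval_mul, h1', h2']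
    ring
  have hcard : A.roots.toFinset.card = A.natDegree := by
    rw [Multiset.toFinset_card_of_nodup hnodup]
    exact (IsAlgClosed.splits A).natDegree_eq_card_roots.symm
  have hmemroots : ∀ {t}, t ∈ A.roots.toFinset ↔ A.IsRoot t := by
    intro t
    rw [Multiset.mem_toFinset, mem_roots hA0]
  have hpt : ∀ t, A.IsRoot t → t ∈ P.domain ∧ P.point t = ![c, P.point t 1] := by
    intro t ht
    obtain ⟨hdt, hct⟩ := hroot t ht
    refine ⟨(mem_domain_iff hden).mpr hdt, ?_⟩
    funext i
    fin_cases i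
    · exact hct
    · rfl
  set g : ℂ[X] := MvPolynomial.aeval ![C c, X] f with hg
  have hgeval : ∀ y, g.eval y = MvPolynomial.eval ![c, y] f := by
    intro y
    rw [hg, ← coe_evalRingHom, MvPolynomial.aeval_def, ← MvPolynomial.coe_eval₂Hom]
    change ((evalRingHom y).comp _) f = _
    congr 1
    refine MvPolynomial.ringHom_ext (fun r => by simp) fun i => ?_
    fin_cases i <;> simp
  have hg0 : g ≠ 0 := by
    intro h
    -- If `g = 0`, the whole line lies on the curve and each of its points has a parameter among the
    -- finitely many roots of `A`.
    refine Set.infinite_univ (α := ℂ) ((A.roots.toFinset.image fun t => P.point t 1).finite_toSet.subset ?_)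
    intro y _
    have hy : ![c, y] ∈ P.curve := (hf.2 _).mpr (by rw [← hgeval, h, eval_zero])
    have hone := hunique _ hy rfl
    obtain ⟨t, ht⟩ := Set.encard_eq_one.mp hone
    obtain ⟨htd, htp⟩ : t ∈ {t ∈ P.domain | P.point t = ![c, y]} := by rw [ht]; rfl
    have htA : A.IsRoot t := by
      have h0 : p.eval t / d.eval t = c := congrFun htp 0
      have hdt := (mem_domain_iff hden).mp htd
      rw [div_eq_iff hdt] at h0
      simp [hA, IsRoot, h0, hd]
    rw [Finset.mem_coe, Finset.mem_image]
    exact ⟨t, hmemroots.mpr htA, by rw [htp]; rfl⟩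
  have hinj : Set.InjOn (fun t => P.point t 1) (A.roots.toFinset : Set ℂ) := by
    intro t ht t' ht' htt'
    obtain ⟨hd1, he1⟩ := hpt t (hmemroots.mp ht)
    obtain ⟨hd2, he2⟩ := hpt t' (hmemroots.mp ht')
    have hsame : P.point t' = P.point t := by
      rw [he2, he1]
      simp only at htt'
      rw [htt']
    have hone := hunique _ (point_mem_curve hd1) (congrFun he1 0)
    exact Set.encard_le_one_iff.mp hone.le t t' ⟨hd1, rfl⟩ ⟨hd2, hsame⟩
  have hsub : (A.roots.toFinset.image fun t => P.point t 1) ⊆ g.roots.toFinset := by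
    intro y hy
    obtain ⟨t, ht, rfl⟩ := Finset.mem_image.mp hy
    obtain ⟨hdt, het⟩ := hpt t (hmemroots.mp ht)
    rw [Multiset.mem_toFinset, mem_roots hg0, IsRoot, hgeval, ← het]
    exact (hf.2 _).mp (point_mem_curve hdt)
  calc d.natDegree ≤ A.natDegree := hAdeg
    _ = (A.roots.toFinset.image fun t => P.point t 1).card := by
      rw [Finset.card_image_of_injOn hinj, hcard]
    _ ≤ g.roots.toFinset.card := Finset.card_le_card hsub
    _ ≤ g.roots.card := Multiset.toFinset_card_le _
    _ ≤ g.natDegree := card_roots' g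
    _ ≤ f.totalDegree * 1 := MvPolynomial.aeval_natDegree_le f le_rfl _ fun i => by
      fin_cases i <;> simp
    _ = f.totalDegree := mul_one _

end IsReduced

/-- The product of the linear forms that vanish at the points at infinity given by the poles. -/
noncomputable def asymptoticForm (P : PlaneParam) : MvPolynomial (Fin 2) ℂ :=
  ((P.den 0).roots.map fun a => MvPolynomial.C ((P.num 0).eval a) * MvPolynomial.X 1 -
    MvPolynomial.C ((P.num 1).eval a) * MvPolynomial.X 0).prod

/-- The resultant of `x₀ * den - num₀` and `x₁ * den - num₁` with respect to the parameter. -/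
noncomputable def implicitResultant (P : PlaneParam) : MvPolynomial (Fin 2) ℂ :=
  resultant (C (MvPolynomial.X 0) * (P.den 0).map MvPolynomial.C - (P.num 0).map MvPolynomial.C)
    (C (MvPolynomial.X 1) * (P.den 0).map MvPolynomial.C - (P.num 1).map MvPolynomial.C)
    (P.den 0).natDegree (P.den 0).natDegree

theorem natDegree_pencil_le {S : Type*} [CommRing S] (φ : ℂ →+* S) (d p : ℂ[X]) (x : S)
    (h : p.natDegree ≤ d.natDegree) : (C x * d.map φ - p.map φ).natDegree ≤ d.natDegree :=
  (natDegree_sub_le _ _).trans (max_le ((natDegree_C_mul_le _ _).trans natDegree_map_le)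
    (natDegree_map_le.trans h))

theorem eval_implicitResultant (hP : P.IsReduced) (hden : P.den 0 = P.den 1)
    (hn : (P.den 0).natDegree ≠ 0) {x : Fin 2 → ℂ} (hx : x ∈ P.curve) :
    MvPolynomial.eval x P.implicitResultant = 0 := by
  refine eval_eq_zero_of_mem_curve (fun t ht => ?_) hx
  have hdt := (mem_domain_iff hden).mp ht
  rw [implicitResultant, ← resultant_map_map]
  have hcomp : (MvPolynomial.eval (P.point t)).comp MvPolynomial.C = RingHom.id ℂ :=
    RingHom.ext fun r => by simp
  have hmap : ∀ k, (C (MvPolynomial.X k) * (P.den 0).map MvPolynomial.C -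
      (P.num k).map MvPolynomial.C).map (MvPolynomial.eval (P.point t)) =
        C (P.point t k) * (P.den 0).map (RingHom.id ℂ) - (P.num k).map (RingHom.id ℂ) := fun k => by
    simp only [Polynomial.map_sub, Polynomial.map_mul, map_C, Polynomial.map_map, hcomp,
      MvPolynomial.eval_X]
  rw [hmap, hmap]
  have hnum : ∀ k, (P.num k).natDegree ≤ (P.den 0).natDegree := fun k => by
    rw [hP.natDegree_eq, den_eq hden]
  -- Both pencils vanish at the parameter `t` of the point. Positive formal degree matters: in
  -- degrees `(0, 0)` the resultant is 1.
  refine resultant_eq_zero_of_common_root _ _ (natDegree_pencil_le _ _ _ _ (hnum 0))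
    (natDegree_pencil_le _ _ _ _ (hnum 1)) hn (t := t) ?_ ?_
  · simp [point, hdt]
  · simp [point, ← hden, hdt]

theorem restrictLine_implicitResultant (P : PlaneParam) (w : Fin 2 → ℂ) :
    MvPolynomial.restrictLine w P.implicitResultant =
      resultant (C (C (w 0) * X) * (P.den 0).map C - (P.num 0).map C)
        (C (C (w 1) * X) * (P.den 0).map C - (P.num 1).map C)
        (P.den 0).natDegree (P.den 0).natDegree := by
  have hcomp : (MvPolynomial.restrictLine w).toRingHom.comp MvPolynomial.C = C :=
    RingHom.ext fun r => by simp [MvPolynomial.restrictLine]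
  have hX : ∀ i, (MvPolynomial.restrictLine w).toRingHom (MvPolynomial.X i) = C (w i) * X :=
    fun i => by simp [MvPolynomial.restrictLine]
  have hmap : ∀ k, (C (MvPolynomial.X k) * (P.den 0).map MvPolynomial.C -
      (P.num k).map MvPolynomial.C).map (MvPolynomial.restrictLine w).toRingHom =
        C (C (w k) * X) * (P.den 0).map C - (P.num k).map C := fun k => by
    simp only [Polynomial.map_sub, Polynomial.map_mul, map_C, Polynomial.map_map, hcomp, hX]
  rw [← hmap, ← hmap, resultant_map_map]
  rfl

/-- With `x` the parameter on the line, `u (v x d - p₁) = (v p₀ - u p₁) + v (u x d - p₀)`, and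
adding a multiple of the first argument to the second preserves the resultant. Now `x` occurs in one
argument only, so the pencil lemmas apply. -/
theorem resultant_line_pencil {d p₀ p₁ : ℂ[X]} (h₀ : p₀.natDegree ≤ d.natDegree) (u v : ℂ) :
    C (u ^ d.natDegree) * resultant (C (C u * X) * d.map C - p₀.map C)
      (C (C v * X) * d.map C - p₁.map C) d.natDegree d.natDegree =
      resultant (C X * (C u * d).map C - p₀.map C) ((C v * p₀ - C u * p₁).map C)
        d.natDegree d.natDegree := by
  have hdeg := natDegree_pencil_le C d p₀ (C u * X) h₀
  have h1 : C X * (C u * d).map C - p₀.map C = C (C u * X) * d.map C - p₀.map C := by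
    simp only [Polynomial.map_mul, map_C, map_mul]
    ring
  have h2 : C (C u) * (C (C v * X) * d.map C - p₁.map C) =
      (C v * p₀ - C u * p₁).map C + (C (C u * X) * d.map C - p₀.map C) * C (C v) := by
    simp only [Polynomial.map_sub, Polynomial.map_mul, map_C, map_mul]
    ring
  rw [C_pow, ← resultant_C_mul_right, h1, h2,
    resultant_add_mul_right _ _ _ _ _ (by rw [natDegree_C, zero_add]) hdeg]

theorem eval_asymptoticForm (P : PlaneParam) (w : Fin 2 → ℂ) :
    MvPolynomial.eval w P.asymptoticForm =
      ((P.den 0).roots.map (C (w 1) * P.num 0 - C (w 0) * P.num 1).eval).prod := by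
  rw [asymptoticForm, map_multiset_prod, Multiset.map_map]
  congr 1
  refine Multiset.map_congr rfl fun a _ => ?_
  simp
  ring

/-- On the line with direction `(u, v)` the coefficient of `x ^ n`, times `u ^ n`, is `Res(u d, v p₀
- u p₁)`, a product over the roots of `d`. Cancelling `u ^ n` needs `u ≠ 0`, which suffices for an
identity of polynomials. -/
theorem homogeneousComponent_implicitResultant (hP : P.IsReduced) (hden : P.den 0 = P.den 1) :
    MvPolynomial.homogeneousComponent (P.den 0).natDegree P.implicitResultant =
      MvPolynomial.C ((P.den 0).leadingCoeff ^ (P.den 0).natDegree) * P.asymptoticForm := by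
  have hnum : ∀ k, (P.num k).natDegree ≤ (P.den 0).natDegree := fun k => by
    rw [hP.natDegree_eq, den_eq hden]
  rw [← sub_eq_zero]
  refine MvPolynomial.eq_zero_of_eval_eq_zero_of_ne 0 fun w hw => ?_
  rw [map_sub, sub_eq_zero, ← MvPolynomial.coeff_restrictLine]
  have h := congrArg (fun q : ℂ[X] => q.coeff (P.den 0).natDegree)
      (resultant_line_pencil (p₁ := P.num 1) (hnum 0) (w 0) (w 1))
  simp only [coeff_C_mul] at h
  rw [← restrictLine_implicitResultant] at h
  rw [coeff_resultant_pencil, resultant_C_mul_left, resultant_eq_prod_eval _ _ _ ?_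
    (IsAlgClosed.splits _)] at h
  · rw [mul_left_cancel₀ (pow_ne_zero _ hw) h, map_mul, MvPolynomial.eval_C, eval_asymptoticForm]
  · exact (natDegree_sub_le _ _).trans (max_le ((natDegree_C_mul_le _ _).trans (hnum 0))
      ((natDegree_C_mul_le _ _).trans (hnum 1)))

theorem totalDegree_implicitResultant_le (hP : P.IsReduced) (hden : P.den 0 = P.den 1) :
    P.implicitResultant.totalDegree ≤ (P.den 0).natDegree := by
  have hnum : ∀ k, (P.num k).natDegree ≤ (P.den 0).natDegree := fun k => by
    rw [hP.natDegree_eq, den_eq hden]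
  refine Finset.sup_le fun s hs => ?_
  by_contra! hlt
  change (P.den 0).natDegree < s.degree at hlt
  have hz : MvPolynomial.homogeneousComponent s.degree P.implicitResultant = 0 := by
    refine MvPolynomial.eq_zero_of_eval_eq_zero_of_ne 0 fun w hw => ?_
    rw [← MvPolynomial.coeff_restrictLine]
    have h := congrArg (fun q : ℂ[X] => q.coeff s.degree)
      (resultant_line_pencil (p₁ := P.num 1) (hnum 0) (w 0) (w 1))
    simp only [coeff_C_mul] at h
    rw [← restrictLine_implicitResultant] at h
    rw [coeff_eq_zero_of_natDegree_lt ((natDegree_resultant_pencil_le _ _ _ _ _).trans_lt hlt)] at h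
    exact (mul_eq_zero.mp h).resolve_left (pow_ne_zero _ hw)
  have := congrArg (MvPolynomial.coeff s) hz
  rw [MvPolynomial.coeff_homogeneousComponent, if_pos rfl] at this
  exact MvPolynomial.mem_support_iff.mp hs this

theorem IsReduced.asymptoticForm_ne_zero (hP : P.IsReduced) : P.asymptoticForm ≠ 0 := by
  rw [asymptoticForm]
  refine Multiset.prod_ne_zero fun h => ?_
  obtain ⟨a, ha, h0⟩ := Multiset.mem_map.mp h
  have hroot : (P.den 0).eval a = 0 := (mem_roots'.mp ha).2
  have := congrArg (MvPolynomial.eval ![0, 1]) h0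
  simp at this
  exact hP.num_eval_ne_zero hroot this

/-- The homogeneous form of maximum degree of the implicit polynomial of a curve with a
reduced parametrization of tracing index one. -/
theorem IsReduced.exists_topForm_eq (hP : P.IsReduced) (hden : P.den 0 = P.den 1)
    (hindex : P.HasTracingIndex 1) {f : MvPolynomial (Fin 2) ℂ}
    (hf : IsImplicitPolynomial f P.curve) :
    ∃ c : ℂ, c ≠ 0 ∧ topForm f = c • P.asymptoticForm := by
  have hn := hP.natDegree_den_ne_zero hden hf
  have hle := hP.natDegree_den_le_totalDegree hden hindex hf
  obtain ⟨g, hg⟩ := hf.dvd fun x hx => eval_implicitResultant hP hden hn hx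
  have hlc : (P.den 0).leadingCoeff ^ (P.den 0).natDegree ≠ 0 :=
    pow_ne_zero _ (leadingCoeff_ne_zero.mpr (hP.den_ne_zero 0))
  have hcomp := homogeneousComponent_implicitResultant hP hden
  have hrhs : MvPolynomial.C ((P.den 0).leadingCoeff ^ (P.den 0).natDegree) * P.asymptoticForm ≠
      0 := mul_ne_zero (MvPolynomial.C_ne_zero.mpr hlc) hP.asymptoticForm_ne_zero
  have hg0 : g ≠ 0 := by
    rintro rfl
    rw [hg, mul_zero, map_zero] at hcomp
    exact hrhs hcomp.symm
  have hdeg := totalDegree_implicitResultant_le hP hden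
  rw [hg, MvPolynomial.totalDegree_mul_of_isDomain hf.1.ne_zero hg0] at hdeg
  -- The degree of `f` is at least `n` and that of the resultant at most `n`, so the cofactor is
  -- constant.
  have hgC := MvPolynomial.totalDegree_eq_zero_iff_eq_C.mp (show g.totalDegree = 0 by omega)
  have hfn : (P.den 0).natDegree = f.totalDegree := by omega
  set b := MvPolynomial.coeff 0 g
  have hb : b ≠ 0 := fun h => hg0 (by rw [hgC, h, map_zero])
  rw [hg, hgC, mul_comm, MvPolynomial.homogeneousComponent_C_mul] at hcomp
  refine ⟨b⁻¹ * (P.den 0).leadingCoeff ^ (P.den 0).natDegree, mul_ne_zero (inv_ne_zero hb) hlc, ?_⟩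
  rw [mul_smul, ← MvPolynomial.C_mul' (a := (P.den 0).leadingCoeff ^ _), ← hcomp,
    ← MvPolynomial.C_mul', ← mul_assoc, ← map_mul, inv_mul_cancel₀ hb, map_one, one_mul, topForm,
    hfn]

end PlaneParam

/-! ### Poles and numerators of the output parametrization -/

namespace PlaneParam

variable {P : PlaneParam} {M N : ℂ[X]}

theorem polyG_eq (P : PlaneParam) (k : Fin 2) :
    P.polyG k = C X * ((P.den k).map C).map C - ((P.num k).map C).map C := by
  rw [polyG, Polynomial.map_map, Polynomial.map_map]
  rfl

theorem polyR_eq (M N : ℂ[X]) : polyR M N = (C X * N.map C - M.map C).map C := by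
  rw [polyR, Polynomial.map_sub, Polynomial.map_mul, Polynomial.map_map, Polynomial.map_map, map_C]
  rfl

/-- No cancellation occurs, since the two terms have different degrees in `x`. This identifies the
degree `ℓ` at which `polyL` takes its resultant. -/
theorem natDegree_pencil_eq (d p : ℂ[X]) :
    (C X * d.map C - p.map C : ℂ[X][X]).natDegree = max p.natDegree d.natDegree := by
  have hcoeff : ∀ j, (C X * d.map C - p.map C : ℂ[X][X]).coeff j =
      X * C (d.coeff j) - C (p.coeff j) := fun j => by simp
  refine le_antisymm ?_ (max_le ?_ ?_)
  · exact (natDegree_sub_le _ _).trans (max_le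
      (((natDegree_C_mul_le _ _).trans natDegree_map_le).trans (le_max_right _ _))
      (natDegree_map_le.trans (le_max_left _ _)))
  · by_cases hp : p = 0
    · simp [hp]
    refine le_natDegree_of_ne_zero fun h => ?_
    rw [hcoeff] at h
    have := congrArg (fun q : ℂ[X] => q.coeff 0) h
    simp [hp] at this
  · by_cases hd : d = 0
    · simp [hd]
    refine le_natDegree_of_ne_zero fun h => ?_
    rw [hcoeff] at h
    have := congrArg (fun q : ℂ[X] => q.coeff 1) h
    simp [hd, coeff_C] at this

theorem natDegree_polyR (M N : ℂ[X]) :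
    (polyR M N).natDegree = max M.natDegree N.natDegree := by
  rw [polyR_eq, natDegree_map_eq_of_injective C_injective, natDegree_pencil_eq]

theorem IsReduced.natDegree_polyG (hP : P.IsReduced) (k : Fin 2) :
    (P.polyG k).natDegree = (P.den k).natDegree := by
  have h : P.polyG k = C X * (P.den k).map (algebraMap ℂ ℂ[X][X]) -
      (P.num k).map (algebraMap ℂ ℂ[X][X]) := rfl
  refine le_antisymm ?_ (le_natDegree_of_ne_zero fun h0 => ?_)
  · exact natDegree_pencil_le _ _ _ _ (hP.natDegree_eq k).le
  · rw [h, coeff_sub, coeff_C_mul, coeff_map, coeff_map] at h0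
    have h1 := congrArg (fun q : ℂ[X][X] => q.coeff 1) h0
    have halg : ∀ a : ℂ, algebraMap ℂ ℂ[X][X] a = C (C a) := fun a => rfl
    simp [halg, coeff_C, hP.den_ne_zero k] at h1

theorem IsReduced.polyL_eq (hP : P.IsReduced) (M N : ℂ[X]) (k : Fin 2) :
    P.polyL M N k = resultant (C X * ((P.den k).map C).map C - ((P.num k).map C).map C)
      ((C X * N.map C - M.map C).map C) (P.den k).natDegree (max M.natDegree N.natDegree) := by
  rw [polyL, hP.natDegree_polyG, natDegree_polyR, polyG_eq, polyR_eq]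

theorem natDegree_specialize_le (M N : ℂ[X]) (s : ℂ) :
    (C s * N - M).natDegree ≤ max M.natDegree N.natDegree :=
  (natDegree_sub_le _ _).trans (max_le ((natDegree_C_mul_le _ _).trans (le_max_right _ _))
    (le_max_left _ _))

theorem map_eval_pencil (d p : ℂ[X]) (s : ℂ) :
    (C X * d.map C - p.map C : ℂ[X][X]).map (evalRingHom s) = C s * d - p := by
  have hcomp : (evalRingHom s).comp C = RingHom.id ℂ := RingHom.ext fun r => by simp
  simp only [Polynomial.map_sub, Polynomial.map_mul, map_C, Polynomial.map_map, hcomp,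
    Polynomial.map_id, coe_evalRingHom, eval_X]

/-- The denominator of the output parametrization, evaluated through the poles of `P`. -/
theorem IsReduced.output_den (hP : P.IsReduced) (M N : ℂ[X]) (k : Fin 2) :
    (P.output M N).den k = C ((P.den k).leadingCoeff ^ max M.natDegree N.natDegree) *
      ((P.den k).roots.map fun a => C (N.eval a) * X - C (M.eval a)).prod := by
  change (P.polyL M N k).coeff (max M.natDegree N.natDegree) = _
  rw [hP.polyL_eq, coeff_resultant_pencil]
  -- The formal degree stays `ℓ` even at values `s` where `s N - M` drops in degree.
  refine Polynomial.funext fun s => ?_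
  have hcomp : (evalRingHom s).comp C = RingHom.id ℂ := RingHom.ext fun r => by simp
  rw [← coe_evalRingHom, ← resultant_map_map, map_eval_pencil, Polynomial.map_map, hcomp,
    Polynomial.map_id, resultant_eq_prod_eval _ _ _ (natDegree_specialize_le M N s)
      (IsAlgClosed.splits _), map_mul, map_multiset_prod, Multiset.map_map]
  congr 1
  · simp
  · congr 1
    refine Multiset.map_congr rfl fun a _ => ?_
    simp only [Function.comp_apply, coe_evalRingHom, eval_sub, eval_mul, eval_C, eval_X]
    ring

/-- The poles of the output parametrization are the images under `M / N` of the poles of `P`,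
with multiplicities. -/
theorem IsReduced.roots_output_den (hP : P.IsReduced) (k : Fin 2)
    (hpole : IsCoprime N (P.den k)) :
    ((P.output M N).den k).roots = (P.den k).roots.map fun a => M.eval a / N.eval a := by
  have hN : ∀ a ∈ (P.den k).roots, N.eval a ≠ 0 := fun a ha h => by
    have hd : (P.den k).eval a = 0 := (mem_roots'.mp ha).2
    obtain ⟨u, v, huv⟩ := hpole
    have := congrArg (eval a) huv
    simp [h, hd] at this
  have hlin : ∀ a ∈ (P.den k).roots, (C (N.eval a) * X - C (M.eval a)).roots =
      {M.eval a / N.eval a} := fun a ha => by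
    rw [roots_C_mul_X_sub_C _ (hN a ha), div_eq_inv_mul]
  rw [hP.output_den, roots_C_mul _ (pow_ne_zero _ (leadingCoeff_ne_zero.mpr (hP.den_ne_zero k))),
    roots_multiset_prod]
  · rw [Multiset.bind_map, Multiset.bind_congr hlin, Multiset.bind_singleton]
  · intro h
    obtain ⟨a, ha, h0⟩ := Multiset.mem_map.mp h
    have := congrArg roots h0
    rw [hlin a ha] at this
    simp at this

/-- At the image of a pole `a` of `P`, the numerators of the output parametrization are
proportional to the numerators of `P` at `a`. -/
theorem IsReduced.exists_output_num_eval (hP : P.IsReduced) (hden : P.den 0 = P.den 1)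
    (hdeg : 0 < max M.natDegree N.natDegree) {a : ℂ} (ha : (P.den 0).eval a = 0)
    (hNa : N.eval a ≠ 0) :
    ∃ κ : ℂ, ∀ k, ((P.output M N).num k).eval (M.eval a / N.eval a) =
      κ * (P.num k).eval a := by
  set s := M.eval a / N.eval a with hs
  have hroot : (C s * N - M).IsRoot a := by
    simp [IsRoot, hs, hNa]
  obtain ⟨E, hE⟩ := dvd_iff_isRoot.mpr hroot
  set l := max M.natDegree N.natDegree with hl
  have hEdeg : E.natDegree ≤ l - 1 := by
    by_cases hE0 : E = 0
    · simp [hE0]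
    have h1 := natDegree_specialize_le M N s
    rw [hE, natDegree_mul (X_sub_C_ne_zero a) hE0, natDegree_X_sub_C] at h1
    omega
  -- The factor `-1 / ℓ` is from the definition of `output`; the signs are from `Res(G_k, t - a)`,
  -- where `G_k(a, x) = -p_k(a)`; and `Res(d, E)` does not involve `k`.
  refine ⟨-(l : ℂ)⁻¹ * ((-1) ^ (P.den 0).natDegree * -1 *
    resultant (P.den 0) E (P.den 0).natDegree (l - 1)), fun k => ?_⟩
  have hmapG : (C X * ((P.den k).map C).map C - ((P.num k).map C).map C : ℂ[X][X][X]).map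
      (mapRingHom (evalRingHom s)) = C X * (P.den 0).map C - (P.num k).map C := by
    have hcomp : ((mapRingHom (evalRingHom s)).comp C).comp C = (C : ℂ →+* ℂ[X]) :=
      RingHom.ext fun r => by simp
    rw [den_eq hden]
    simp only [Polynomial.map_sub, Polynomial.map_mul, map_C, Polynomial.map_map,
      ← RingHom.comp_assoc, hcomp, coe_mapRingHom, map_X]
  have hmapR : ((C X * N.map C - M.map C : ℂ[X][X]).map C).map (mapRingHom (evalRingHom s)) =
      (X - C (C a)) * E.map C := by
    have hcomp : (mapRingHom (evalRingHom s)).comp C = (C : ℂ →+* ℂ[X]).comp (evalRingHom s) :=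
      RingHom.ext fun r => by simp
    rw [Polynomial.map_map, hcomp, ← Polynomial.map_map, map_eval_pencil, hE]
    simp
  have hGdeg : (C X * (P.den 0).map C - (P.num k).map C : ℂ[X][X]).natDegree ≤
      (P.den 0).natDegree :=
    natDegree_pencil_le _ _ _ _ (by rw [hP.natDegree_eq, den_eq hden])
  have hGa : (C X * (P.den 0).map C - (P.num k).map C : ℂ[X][X]).eval (C a) =
      -C ((P.num k).eval a) := by
    simp [eval_map_apply, ha]
  have hL : (P.polyL M N k).map (evalRingHom s) =
      C ((-1) ^ (P.den 0).natDegree * -(P.num k).eval a) *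
        resultant (C X * (P.den 0).map C - (P.num k).map C) (E.map C) (P.den 0).natDegree
          (l - 1) := by
    have hsplit := resultant_mul_right_of_natDegree_le
      (C X * (P.den 0).map C - (P.num k).map C : ℂ[X][X]) (X - C (C a)) (E.map C) hGdeg
      (natDegree_map_le.trans hEdeg)
    rw [natDegree_X_sub_C, resultant_X_sub_C_right _ _ _ hGdeg, hGa,
      show 1 + (l - 1) = l by omega] at hsplit
    rw [hP.polyL_eq, ← coe_mapRingHom, ← resultant_map_map, hmapG, hmapR, den_eq hden k, ← hl,
      hsplit]
    simp
  have hcoeff := congrArg (fun q : ℂ[X] => q.coeff (l - 1)) hL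
  simp only [coeff_map, coeff_C_mul, coeff_resultant_pencil, coe_evalRingHom] at hcoeff
  change (C (-(l : ℂ)⁻¹) * (P.polyL M N k).coeff (l - 1)).eval s = _
  rw [eval_mul, eval_C, hcoeff]
  ring

end PlaneParam

theorem theorem4 (P : PlaneParam) (M N : ℂ[X])
    (hden : P.den 0 = P.den 1) (hP : P.IsReduced) (hPindex : P.HasTracingIndex 1)
    (hMN : IsCoprime M N) (hR : 0 < (M * N).natDegree)
    (hpole : ∀ k, IsCoprime N (P.den k))
    (hQ : (P.output M N).IsReduced) (hQindex : (P.output M N).HasTracingIndex 1)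
    (f h : MvPolynomial (Fin 2) ℂ)
    (hf : IsImplicitPolynomial f P.curve)
    (hh : IsImplicitPolynomial h (P.output M N).curve) :
    (∃ c : ℂ, c ≠ 0 ∧ topForm f = c • topForm h) ∧
      pointsAtInfinity P.curve = pointsAtInfinity (P.output M N).curve := by
  have hdeg : 0 < max M.natDegree N.natDegree := by
    have := natDegree_mul_le (p := M) (q := N)
    omega
  have hQden : (P.output M N).den 0 = (P.output M N).den 1 := by
    rw [hP.output_den, hP.output_den, hden]
  have hQroots := hP.roots_output_den (M := M) 0 (hpole 0)
  have hκ : ∀ a ∈ (P.den 0).roots, ∃ κ : ℂ, κ ≠ 0 ∧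
      ∀ k, ((P.output M N).num k).eval (M.eval a / N.eval a) = κ * (P.num k).eval a := by
    intro a ha
    have hda : (P.den 0).eval a = 0 := (mem_roots'.mp ha).2
    have hNa : N.eval a ≠ 0 := fun h0 => by
      obtain ⟨u, v, huv⟩ := hpole 0
      have := congrArg (eval a) huv
      simp [h0, hda] at this
    obtain ⟨κ, hκ⟩ := hP.exists_output_num_eval hden hdeg hda hNa
    -- `κ = 0` would make a numerator of the output vanish at its pole `R(a)`, against coprimality.
    refine ⟨κ, fun h0 => ?_, hκ⟩
    have hroot : M.eval a / N.eval a ∈ ((P.output M N).den 0).roots := by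
      rw [hQroots]
      exact Multiset.mem_map_of_mem _ ha
    exact hQ.num_eval_ne_zero (k := 0) (mem_roots'.mp hroot).2 (by rw [hκ, h0, zero_mul])
  choose! κ hκ0 hκ using hκ
  have hform : (P.output M N).asymptoticForm =
      ((P.den 0).roots.map κ).prod • P.asymptoticForm := by
    rw [PlaneParam.asymptoticForm, hQroots, Multiset.map_map, PlaneParam.asymptoticForm,
      ← MvPolynomial.C_mul', map_multiset_prod, Multiset.map_map, ← Multiset.prod_map_mul]
    congr 1
    refine Multiset.map_congr rfl fun a ha => ?_
    simp only [Function.comp_apply, hκ a ha, map_mul]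
    ring
  have hprod : ((P.den 0).roots.map κ).prod ≠ 0 := by
    refine Multiset.prod_ne_zero fun h0 => ?_
    obtain ⟨a, ha, ha0⟩ := Multiset.mem_map.mp h0
    exact hκ0 a ha ha0
  obtain ⟨c, hc, hcf⟩ := hP.exists_topForm_eq hden hPindex hf
  obtain ⟨b, hb, hbh⟩ := hQ.exists_topForm_eq hQden hQindex hh
  have htop : topForm f = (c * (b * ((P.den 0).roots.map κ).prod)⁻¹) • topForm h := by
    rw [hbh, hform, hcf, smul_smul, smul_smul, mul_assoc, mul_assoc,
      inv_mul_cancel₀ (mul_ne_zero hb hprod), mul_one]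
  have hne : c * (b * ((P.den 0).roots.map κ).prod)⁻¹ ≠ 0 :=
    mul_ne_zero hc (inv_ne_zero (mul_ne_zero hb hprod))
  refine ⟨⟨_, hne, htop⟩, Set.ext fun q => ?_⟩
  rw [hf.mem_pointsAtInfinity_iff, hh.mem_pointsAtInfinity_iff, htop, MvPolynomial.smul_eval,
    mul_eq_zero, or_iff_right hne]
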